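/- **Conventions.** A non-degenerate real cubic is a curve $\mathcal C$ given by $\varphi(x,y)=0$, where $\varphi\in\mathbb R[x,y]$ is irreducible of total degree $3$ (irreducibility over $\mathbb R$ and over $\mathbb C$ are equivalent here); its points at infinity are the directions at which the cubic part of $\varphi$ vanishes. A quadrilateral $A_1A_2A_3A_4$ consists of four distinct points of $\mathbb R^2$ (possibly collinear or self-intersecting). For $X\in\mathbb R^2$ other than the vertices, the pairs of lines $(XA_1,XA_3)$, $(XA_2,XA_4)$ are *isogonal* if they have the same pair of angle bisectors; for $X$ a real point at infinity, they are isogonal if every line not through $X$ meets $XA_1,XA_2,XA_3,XA_4$ in points $U_1,U_2,U_3,U_4$ with $\overrightarrow{U_1U_2}=\overrightarrow{U_4U_3}$. $\mathcal C$ is the *isogonal cubic* of $A_1A_2A_3A_4$ if its points in $\mathbb{RP}^2$ are exactly the vertices together with all points $X$ for which these pairs are isogonal. The *spiral center* of $A_1A_2A_3A_4$ is the center of the spiral similarity that maps $A_1\mapsto A_2$ and $A_4\mapsto A_3$; the *spiral center of an isogonal cubic* $\mathcal C$ is the common spiral center of all quadrilaterals whose isogonal cubic is $\mathcal C$. An *asymptote*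 of $\mathcal C$ is a real line $\ell$ such that some continuous path on $\mathcal C\cap\mathbb R^2$ tends to infinity while its distance to $\ell$ tends to $0$. **Theorem.** A non-degenerate real cubic $\mathcal C$ is the isogonal cubic of some quadrilateral if and only if it has an equation of the form $f(x,y)=f(p,q)$, where $$f(x,y)=Ax^3+Bx^2y+Axy^2+By^3+Cx^2+Dxy+Ey^2+Fx+Gy$$ with real coefficients, $(A,B)\neq(0,0)$, and $$p=\frac{AE-AC-BD}{2(A^2+B^2)},\qquad q=\frac{BC-AD-BE}{2(A^2+B^2)}.$$ Furthermore, whenever $\mathcal C$ has such an equation, the spiral center of $\mathcal C$ exists, is unique and equals $(p,q)$, and $\mathcal C$ has exactly one real asymptote, namely the line $$(A^3+AB^2)x+(A^2B+B^3)y+(A^2E-ABD+B^2C)=0.$$ -/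

import Mathlib

/-!
The Euclidean plane `ℝ²` is identified with `ℂ`; the point `(x, y)` is `x + i y`.
A plane cubic is given by its equation, a polynomial in two variables of total degree three.
-/

namespace IsogonalCubic

/-- The real line of direction `u` bisects the pair of lines of directions `v` and `w`
(all three through one common point): the reflection in the first line carries the line of
direction `v` onto the line of direction `w`. -/
def IsBisector (u v w : ℂ) : Prop :=
  u ≠ 0 ∧ Submodule.span ℝ {(Submodule.span ℝ {u}).reflection v} = Submodule.span ℝ {w}

/-- The pairs of lines `(Xa, Xc)` and `(Xb, Xd)` have the same pair of angle bisectors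
(used for `X` different from the four points). -/
def Isogonal (X a b c d : ℂ) : Prop :=
  ∀ u : ℂ, IsBisector u (a - X) (c - X) ↔ IsBisector u (b - X) (d - X)

/-- Isogonality at the point at infinity of direction `v`: whenever a line, of a direction `w`
not parallel to `v`, meets the parallels to `v` through `a, b, c, d` at `e, f, g, h`, the directed
segments `ef` and `hg` agree. -/
def IsogonalAtInfinity (v a b c d : ℂ) : Prop :=
  ∀ w : ℂ, w ∉ Submodule.span ℝ {v} → ∀ e f g h : ℂ,
    e - a ∈ Submodule.span ℝ {v} → f - b ∈ Submodule.span ℝ {v} →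
    g - c ∈ Submodule.span ℝ {v} → h - d ∈ Submodule.span ℝ {v} →
    f - e ∈ Submodule.span ℝ {w} → g - e ∈ Submodule.span ℝ {w} →
    h - e ∈ Submodule.span ℝ {w} → f - e = g - h

/-- The value of a real polynomial in two variables at a point of the plane. -/
noncomputable def evalAt (φ : MvPolynomial (Fin 2) ℝ) (X : ℂ) : ℝ :=
  MvPolynomial.eval ![X.re, X.im] φ

/-- The set of real points of the affine curve `φ = 0`. -/
def curve (φ : MvPolynomial (Fin 2) ℝ) : Set ℂ := {X | evalAt φ X = 0}

/-- The cubic `φ = 0` is the isogonal cubic of the quadrilateral `abcd`: the vertices are distinct,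
and the points of the cubic in the real projective plane are the vertices together with all points
`X` such that `(Xa, Xc)` and `(Xb, Xd)` are isogonal. The points at infinity of a cubic are the
directions at which its cubic part vanishes. -/
def IsIsogonalCubicOf (φ : MvPolynomial (Fin 2) ℝ) (a b c d : ℂ) : Prop :=
  [a, b, c, d].Nodup ∧
  (∀ X : ℂ, X ∈ curve φ ↔ (X = a ∨ X = b ∨ X = c ∨ X = d) ∨ Isogonal X a b c d) ∧
  (∀ v : ℂ, v ≠ 0 →
    (evalAt (MvPolynomial.homogeneousComponent 3 φ) v = 0 ↔ IsogonalAtInfinity v a b c d))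

/-- `P` is the spiral center of the quadrilateral `abcd`: the center of a spiral similarity
`z ↦ P + w (z - P)` that maps `a` to `b` and `d` to `c`. -/
def IsSpiralCenterOf (P a b c d : ℂ) : Prop :=
  ∃ w : ℂ, w ≠ 0 ∧ P + w * (a - P) = b ∧ P + w * (d - P) = c

/-- `P` is the spiral center of the isogonal cubic `φ = 0`: the common spiral center of all
quadrilaterals of which this is the isogonal cubic (and there is such a quadrilateral). -/
def IsSpiralCenterOfCubic (φ : MvPolynomial (Fin 2) ℝ) (P : ℂ) : Prop :=
  (∃ a b c d : ℂ, IsIsogonalCubicOf φ a b c d) ∧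
  ∀ a b c d : ℂ, IsIsogonalCubicOf φ a b c d → IsSpiralCenterOf P a b c d

/-- The line `ℓ` is an asymptote of `S`: some continuous path in `S` goes to infinity while its
distance to `ℓ` tends to zero. -/
def IsAsymptote (S : Set ℂ) (ℓ : AffineSubspace ℝ ℂ) : Prop :=
  Module.finrank ℝ ℓ.direction = 1 ∧
  ∃ γ : ℝ → ℂ, Continuous γ ∧ (∀ t, γ t ∈ S) ∧
    Filter.Tendsto (fun t => ‖γ t‖) Filter.atTop Filter.atTop ∧
    Filter.Tendsto (fun t => Metric.infDist (γ t) (ℓ : Set ℂ)) Filter.atTop (nhds 0)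

/-- `f = A x³ + B x² y + A x y² + B y³ + C x² + D x y + E y² + F x + G y`. -/
noncomputable def form (A B C D E F G : ℝ) : MvPolynomial (Fin 2) ℝ :=
  let x : MvPolynomial (Fin 2) ℝ := MvPolynomial.X 0
  let y : MvPolynomial (Fin 2) ℝ := MvPolynomial.X 1
  A • x ^ 3 + B • (x ^ 2 * y) + A • (x * y ^ 2) + B • y ^ 3 + C • x ^ 2 + D • (x * y) + E • y ^ 2
    + F • x + G • y

/-- The point `(p, q)`. -/
noncomputable def center (A B C D E : ℝ) : ℂ :=
  ⟨(A * E - A * C - B * D) / (2 * (A ^ 2 + B ^ 2)),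
    (B * C - A * D - B * E) / (2 * (A ^ 2 + B ^ 2))⟩

/-- The cubic `φ = 0` is `f(x, y) = f(p, q)`. -/
def HasForm (φ : MvPolynomial (Fin 2) ℝ) (A B C D E F G : ℝ) : Prop :=
  φ = form A B C D E F G
    - MvPolynomial.C (evalAt (form A B C D E F G) (center A B C D E))

end IsogonalCubic

namespace IsogonalCubic

open ComplexConjugate Filter Topology

/-! In complex coordinates the pairs at `X` are isogonal iff `(a - X)(c - X)` is a real multiple of
`(b - X)(d - X)`. The spiral center `P` is the point where these two products take one common value
`m`. With `Z = X - P`, `s = a + c - 2P`, `t = b + d - 2P`, the condition reads `Im ((Z² - sZ + m) *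
conj (Z² - tZ + m)) = 0`. Since `m` is common, the terms `Z² * conj m` and `m * conj Z²` are
conjugate, and what remains is `|Z|² (Ax + By + S) + Hx + Ky` (`isogonalForm_eq_cubicAt`). The
equations `f(x, y) = f(p, q)` are exactly the translates of such cubics, with `(p, q)` as the new
origin.

Conversely, irreducibility forces `(H, K) ≠ 0`, and a quadrilateral is read off from the roots of
`z² - sz + m` and `z² - tz + m` for suitable `s, t, m` (`exists_quadrilateral`). That a curve
determines its equation up to a factor follows from a Gauss lemma argument, as every line of one
parallel family contains a real point of the cubic (`dvd_of_common_zeros`, `exists_eq_mul_evalAt`).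
For the asymptote, the equation gives `|Ax + By + S| ≤ (|H| + |K|) / |Z|`, so only one line is
possible; a continuous branch of real roots reaches it (`exists_path`). -/

/-- The imaginary part of `(a - X) (c - X)` times the conjugate of `(b - X) (d - X)`; away from the
vertices it vanishes exactly at the points where the two pairs of lines are isogonal. -/
noncomputable def isogonalForm (a b c d X : ℂ) : ℝ :=
  ((a - X) * (c - X) * conj ((b - X) * (d - X))).im

/-- A cubic function through the origin whose cubic and quadratic parts are multiples of
`x ^ 2 + y ^ 2`. -/
def cubicAt (A B S H K : ℝ) (Z : ℂ) : ℝ :=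
  (Z.re ^ 2 + Z.im ^ 2) * (A * Z.re + B * Z.im + S) + H * Z.re + K * Z.im

/-! ### Isogonality as a real equation. -/

theorem mem_span_singleton_iff {v z : ℂ} (hv : v ≠ 0) :
    z ∈ Submodule.span ℝ {v} ↔ (z * conj v).im = 0 := by
  rw [Submodule.mem_span_singleton]
  constructor
  · rintro ⟨r, rfl⟩
    simp [Complex.mul_im, Complex.mul_re]
    ring
  · intro h
    have hv' : Complex.normSq v ≠ 0 := by simpa using hv
    refine ⟨(z * conj v).re / Complex.normSq v, ?_⟩
    have h1 : z * conj v = ((z * conj v).re : ℂ) := by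
      apply Complex.ext <;> simp [h]
    have h2 : (Complex.normSq v : ℂ) ≠ 0 := by exact_mod_cast hv'
    rw [Complex.real_smul, Complex.ofReal_div, ← h1, Complex.normSq_eq_conj_mul_self]
    have h3 : conj v ≠ 0 := by simpa using hv
    field_simp

theorem span_singleton_eq_iff {v z : ℂ} (hv : v ≠ 0) (hz : z ≠ 0) :
    Submodule.span ℝ {z} = Submodule.span ℝ {v} ↔ (z * conj v).im = 0 := by
  rw [← mem_span_singleton_iff hv]
  constructor
  · intro h
    rw [← h]
    exact Submodule.mem_span_singleton_self z
  · intro h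
    obtain ⟨r, rfl⟩ := Submodule.mem_span_singleton.1 h
    have hr : r ≠ 0 := by
      rintro rfl
      simp at hz
    exact Submodule.span_singleton_smul_eq (IsUnit.mk0 r hr) v

/-- Reflection in the line of `u` sends `v` to `u * conj v / conj u`. Hence the bisectors depend
only on the product `v * w` up to a real factor. -/
theorem isBisector_iff {u v w : ℂ} (hv : v ≠ 0) (hw : w ≠ 0) :
    IsBisector u v w ↔ u ≠ 0 ∧ (u ^ 2 * conj (v * w)).im = 0 := by
  unfold IsBisector
  refine and_congr_right fun hu => ?_
  rw [span_singleton_eq_iff hw (by simpa using hv), Submodule.reflection_singleton_apply]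
  have hN : u.re ^ 2 + u.im ^ 2 ≠ 0 := by
    have : Complex.normSq u ≠ 0 := by simpa using hu
    rw [Complex.normSq_apply] at this
    simpa [sq] using this
  have hn : ‖u‖ ^ 2 = u.re ^ 2 + u.im ^ 2 := by
    rw [Complex.sq_norm, Complex.normSq_apply]; ring
  rw [RCLike.ofReal_real_eq_id, id, hn, Complex.inner]
  obtain ⟨k, hk⟩ : ∃ k : ℝ, k = (v * conj u).re / (u.re ^ 2 + u.im ^ 2) := ⟨_, rfl⟩
  have hk' : k * (u.re ^ 2 + u.im ^ 2) = u.re * v.re + u.im * v.im := by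
    rw [hk, div_mul_cancel₀ _ hN]
    simp [Complex.mul_re, mul_comm]
  have key : ((2 • k • u - v) * conj w).im * (u.re ^ 2 + u.im ^ 2)
      = (u ^ 2 * conj (v * w)).im := by
    simp only [Complex.mul_im, Complex.mul_re, pow_two, Complex.conj_re, Complex.conj_im,
      Complex.sub_re, Complex.sub_im, two_smul, Complex.add_re, Complex.add_im, Complex.real_smul,
      Complex.ofReal_re, Complex.ofReal_im]
    linear_combination (2 * u.im * w.re - 2 * u.re * w.im) * hk'
  rw [← hk, ← key]
  simp [hN]

theorem isogonal_iff {X a b c d : ℂ} (ha : X ≠ a) (hb : X ≠ b) (hc : X ≠ c) (hd : X ≠ d) :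
    Isogonal X a b c d ↔ isogonalForm a b c d X = 0 := by
  have ha := sub_ne_zero.2 ha.symm
  have hb := sub_ne_zero.2 hb.symm
  have hc := sub_ne_zero.2 hc.symm
  have hd := sub_ne_zero.2 hd.symm
  unfold Isogonal isogonalForm
  simp only [isBisector_iff ha hc, isBisector_iff hb hd]
  set p := (a - X) * (c - X) with hp
  set q := (b - X) * (d - X) with hq
  have hp0 : p ≠ 0 := mul_ne_zero ha hc
  have hq0 : q ≠ 0 := mul_ne_zero hb hd
  constructor
  -- A square root of `p` is a bisector direction of the first pair; testing it alone suffices.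
  · intro h
    obtain ⟨u, hu⟩ := IsAlgClosed.exists_pow_nat_eq p (n := 2) two_pos
    have hu0 : u ≠ 0 := by
      rintro rfl
      exact hp0 (by simpa using hu.symm)
    have := ((h u).1 ⟨hu0, by rw [hu, Complex.mul_conj]; simp⟩).2
    rwa [hu] at this
  · intro h u
    refine and_congr_right fun _ => ?_
    rw [← mem_span_singleton_iff hp0, ← mem_span_singleton_iff hq0]
    rw [← span_singleton_eq_iff hq0 hp0] at h
    rw [h]

theorem isogonalForm_eq_zero_iff {a b c d : ℂ} (X : ℂ) :
    ((X = a ∨ X = b ∨ X = c ∨ X = d) ∨ Isogonal X a b c d) ↔ isogonalForm a b c d X = 0 := by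
  by_cases h : X = a ∨ X = b ∨ X = c ∨ X = d
  · simp only [h, true_or, true_iff]
    unfold isogonalForm
    rcases h with rfl | rfl | rfl | rfl <;> simp
  · simp only [h, false_or]
    push Not at h
    exact isogonal_iff h.1 h.2.1 h.2.2.1 h.2.2.2

/-- Projection along `v` is affine, so the segments agree iff `b + d - a - c` projects to zero. A
single transversal, the perpendicular `I * v`, already detects this. -/
theorem isogonalAtInfinity_iff {v a b c d : ℂ} (hv : v ≠ 0) :
    IsogonalAtInfinity v a b c d ↔ ((b + d - a - c) * conj v).im = 0 := by
  rw [← mem_span_singleton_iff hv]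
  have hI : Complex.I * v ∉ Submodule.span ℝ {v} := by
    rw [mem_span_singleton_iff hv, mul_assoc, Complex.mul_conj]
    simpa using hv
  constructor
  · intro h
    have hproj : ∀ z : ℂ, ∃ r : ℝ, a + r • (Complex.I * v) - z ∈ Submodule.span ℝ {v} := by
      intro z
      have hv' : Complex.normSq v ≠ 0 := by simpa using hv
      obtain ⟨r, hr⟩ : ∃ r : ℝ, r * Complex.normSq v = ((z - a) * conj v).im :=
        ⟨_, div_mul_cancel₀ _ hv'⟩
      refine ⟨r, ?_⟩
      rw [mem_span_singleton_iff hv]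
      rw [Complex.normSq_apply] at hr
      simp [Complex.mul_im, Complex.mul_re] at hr ⊢
      linear_combination hr
    obtain ⟨r, hr⟩ := hproj b
    obtain ⟨s, hs⟩ := hproj c
    obtain ⟨t, ht⟩ := hproj d
    have hm : ∀ r : ℝ, a + r • (Complex.I * v) - a ∈ Submodule.span ℝ {Complex.I * v} := fun r => by
      rw [add_sub_cancel_left]
      exact Submodule.smul_mem _ _ (Submodule.mem_span_singleton_self _)
    have h1 := h _ hI a _ _ _ (by simp) hr hs ht (hm r) (hm s) (hm t)
    have h2 := Submodule.sub_mem _ (Submodule.sub_mem _ hs ht) hr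
    convert h2 using 1
    linear_combination h1
  · intro h w hw e f g k he hf hg hk hfe hge hke
    have h1 : f - e - (g - k) ∈ Submodule.span ℝ {w} := by
      have := Submodule.sub_mem _ (Submodule.add_mem _ hfe hke) hge
      convert this using 1
      ring
    have h2 : f - e - (g - k) ∈ Submodule.span ℝ {v} := by
      have := Submodule.add_mem _ h (Submodule.sub_mem _ (Submodule.add_mem _ hf hk)
        (Submodule.add_mem _ he hg))
      convert this using 1
      ring
    by_contra hne
    have h3 : f - e - (g - k) ≠ 0 := sub_ne_zero.2 hne
    have hw0 : w ≠ 0 := by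
      rintro rfl
      simp at hw
    apply hw
    have e1 := (span_singleton_eq_iff hw0 h3).2 ((mem_span_singleton_iff hw0).1 h1)
    have e2 := (span_singleton_eq_iff hv h3).2 ((mem_span_singleton_iff hv).1 h2)
    rw [← e2, e1]
    exact Submodule.mem_span_singleton_self w

/-! ### Divisibility from common real zeros. -/

/-- Two polynomials over a domain that are coprime over the fraction field have a nonzero constant
in the ideal they generate. -/
theorem exists_C_eq_of_isCoprime_map {S : Type*} [CommRing S] [IsDomain S] {p q : Polynomial S}
    (h : IsCoprime (p.map (algebraMap S (FractionRing S)))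
      (q.map (algebraMap S (FractionRing S)))) :
    ∃ r : S, r ≠ 0 ∧ ∃ u v, u * p + v * q = Polynomial.C r := by
  obtain ⟨a, b, hab⟩ := h
  obtain ⟨c, hc0, hc⟩ := IsLocalization.integerNormalization_spec (nonZeroDivisors S) a
  obtain ⟨d, hd0, hd⟩ := IsLocalization.integerNormalization_spec (nonZeroDivisors S) b
  refine ⟨c * d, mul_ne_zero (nonZeroDivisors.ne_zero hc0) (nonZeroDivisors.ne_zero hd0),
    Polynomial.C d * IsLocalization.integerNormalization (nonZeroDivisors S) a,
    Polynomial.C c * IsLocalization.integerNormalization (nonZeroDivisors S) b, ?_⟩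
  apply Polynomial.map_injective _ (IsFractionRing.injective S (FractionRing S))
  simp only [Polynomial.map_add, Polynomial.map_mul, hc, hd, Polynomial.map_C, map_mul]
  simp only [Algebra.smul_def, Polynomial.algebraMap_apply]
  linear_combination (Polynomial.C (algebraMap S (FractionRing S) c) *
    Polynomial.C (algebraMap S (FractionRing S) d)) * hab

/-- Regard `p` and `q` as polynomials in `x` over `ℝ[y]`. If they were coprime over `ℝ(y)`, clearing
denominators would give a nonzero `r(y) = up + vq` that vanishes at every real `y`. So `p` divides
`q` over `ℝ(y)`, and over `ℝ[y]` because `p` is primitive. -/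
theorem dvd_of_common_zeros {p q : MvPolynomial (Fin 2) ℝ} (hp : Irreducible p)
    (h : ∀ y : ℝ, ∃ x : ℝ, MvPolynomial.eval ![x, y] p = 0 ∧ MvPolynomial.eval ![x, y] q = 0) :
    p ∣ q := by
  set e := MvPolynomial.finSuccEquiv ℝ 1
  have he : ∀ (f : MvPolynomial (Fin 2) ℝ) (x y : ℝ), MvPolynomial.eval ![x, y] f =
      Polynomial.eval x (Polynomial.map (MvPolynomial.eval ![y]) (e f)) := fun f x y =>
    MvPolynomial.eval_eq_eval_mv_eval' ![y] x f
  have hzero : ∀ r : MvPolynomial (Fin 1) ℝ, (∀ y : ℝ, MvPolynomial.eval ![y] r = 0) → r = 0 := by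
    intro r hr
    refine MvPolynomial.funext fun z => ?_
    have : z = ![z 0] := by ext i; fin_cases i; rfl
    rw [this, hr, map_zero]
  rw [← map_dvd_iff e]
  have hirr : Irreducible (e p) := (MulEquiv.irreducible_iff e).2 hp
  have hdeg : (e p).natDegree ≠ 0 := by
    intro h0
    rw [Polynomial.natDegree_eq_zero] at h0
    obtain ⟨s, hs⟩ := h0
    have hs0 : s = 0 := hzero s fun y => by
      obtain ⟨x, hx, -⟩ := h y
      rw [he, ← hs] at hx
      simpa using hx
    apply hirr.ne_zero
    rw [← hs, hs0, map_zero]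
  have hprim := hirr.isPrimitive hdeg
  have hK := (hprim.irreducible_iff_irreducible_map_fraction_map
    (K := FractionRing (MvPolynomial (Fin 1) ℝ))).1 hirr
  rcases hK.isCoprime_or_dvd ((e q).map (algebraMap _ _)) with hc | hd
  · exfalso
    obtain ⟨r, hr0, u, v, huv⟩ := exists_C_eq_of_isCoprime_map hc
    refine hr0 (hzero r fun y => ?_)
    obtain ⟨x, hx1, hx2⟩ := h y
    rw [he] at hx1 hx2
    have := congrArg (fun f => Polynomial.eval x (Polynomial.map (MvPolynomial.eval ![y]) f)) huv
    simpa [hx1, hx2] using this.symm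
  · exact (hprim.dvd_iff_fraction_map_dvd_fraction_map _).2 hd

/-! ### The normal form at the spiral center, and quadrilaterals realizing it. -/

theorem isogonalForm_eq_cubicAt {a b c d P : ℂ} (h : (a - P) * (c - P) = (b - P) * (d - P))
    (X : ℂ) : isogonalForm a b c d X =
      cubicAt (b + d - a - c).im (-(b + d - a - c).re) ((a + c - 2 * P) * conj (b + d - 2 * P)).im
        (-((a - P) * (c - P) * conj (b + d - a - c)).im)
        ((a - P) * (c - P) * conj (b + d - a - c)).re (X - P) := by
  obtain ⟨Z, rfl⟩ : ∃ Z, X = P + Z := ⟨X - P, by ring⟩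
  obtain ⟨s, hs⟩ : ∃ s, s = a + c - 2 * P := ⟨_, rfl⟩
  obtain ⟨t, ht⟩ : ∃ t, t = b + d - 2 * P := ⟨_, rfl⟩
  have hδ : b + d - a - c = t - s := by rw [hs, ht]; ring
  have e1 : (a - (P + Z)) * (c - (P + Z)) = Z ^ 2 - s * Z + (a - P) * (c - P) := by
    rw [hs]; ring
  have e2 : (b - (P + Z)) * (d - (P + Z)) = Z ^ 2 - t * Z + (a - P) * (c - P) := by
    rw [ht]; linear_combination -h
  rw [isogonalForm, e1, e2, hδ, ← hs, ← ht]
  generalize (a - P) * (c - P) = m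
  simp only [cubicAt, Complex.mul_im, Complex.mul_re, pow_two, Complex.conj_re, Complex.conj_im,
    Complex.sub_re, Complex.sub_im, Complex.add_re, Complex.add_im]
  ring

theorem exists_mul_eq_mul {a b c d : ℂ} (h : b + d - a - c ≠ 0) :
    ∃ P : ℂ, (a - P) * (c - P) = (b - P) * (d - P) := by
  refine ⟨(b * d - a * c) / (b + d - a - c), ?_⟩
  field_simp
  ring

/-- The ratio is `w = (b - P) / (a - P) = (c - P) / (d - P)`; distinctness of the vertices keeps `P`
away from them. -/
theorem isSpiralCenterOf_iff {a b c d : ℂ} (hnd : [a, b, c, d].Nodup) (P : ℂ) :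
    IsSpiralCenterOf P a b c d ↔ (a - P) * (c - P) = (b - P) * (d - P) := by
  simp only [List.nodup_cons, List.mem_cons, List.not_mem_nil, or_false, not_or, not_false_eq_true,
    List.nodup_nil, and_true] at hnd
  obtain ⟨⟨hab, hac, had⟩, ⟨hbc, hbd⟩, hcd⟩ := hnd
  constructor
  · rintro ⟨w, -, h1, h2⟩
    rw [← h1, ← h2]
    ring
  · intro h
    have hb : b - P ≠ 0 := by
      intro h0
      rw [h0, zero_mul, mul_eq_zero, sub_eq_zero, sub_eq_zero] at h
      rw [sub_eq_zero] at h0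
      rcases h with h | h
      · exact hab (h.trans h0.symm)
      · exact hbc (h0.trans h.symm)
    have hd : d - P ≠ 0 := by
      intro h0
      rw [h0, mul_zero, mul_eq_zero, sub_eq_zero, sub_eq_zero] at h
      rw [sub_eq_zero] at h0
      rcases h with h | h
      · exact had (h.trans h0.symm)
      · exact hcd (h.trans h0.symm)
    have ha : a - P ≠ 0 := left_ne_zero_of_mul (h ▸ mul_ne_zero hb hd)
    refine ⟨(b - P) / (a - P), div_ne_zero hb ha, ?_, ?_⟩
    · field_simp
      ring
    · field_simp
      linear_combination -h

theorem exists_root_cubic {c₃ : ℝ} (h : 0 < c₃) (c₂ c₁ c₀ : ℝ) :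
    ∃ x : ℝ, c₃ * x ^ 3 + c₂ * x ^ 2 + c₁ * x + c₀ = 0 := by
  -- `M` is chosen so that at `±M` the leading term outweighs the sum of the others.
  obtain ⟨M, hM⟩ : ∃ M : ℝ, M = 1 + (|c₂| + |c₁| + |c₀|) / c₃ := ⟨_, rfl⟩
  have hM1 : 1 ≤ M := by
    rw [hM]
    have : 0 ≤ (|c₂| + |c₁| + |c₀|) / c₃ := by positivity
    linarith
  have hcM : c₃ * M = c₃ + |c₂| + |c₁| + |c₀| := by
    rw [hM]
    field_simp
    ring
  have hM3 : c₃ * M ^ 3 = M ^ 2 * c₃ + |c₂| * M ^ 2 + |c₁| * M ^ 2 + |c₀| * M ^ 2 := by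
    linear_combination M ^ 2 * hcM
  have h0 : 0 < M ^ 2 * c₃ := by positivity
  have h2 : |c₂ * M ^ 2| = |c₂| * M ^ 2 := by rw [abs_mul, abs_of_nonneg (sq_nonneg M)]
  have h1 : |c₁ * M| ≤ |c₁| * M ^ 2 := by
    rw [abs_mul, abs_of_nonneg (by linarith : 0 ≤ M)]
    gcongr
    nlinarith
  have h00 : |c₀| ≤ |c₀| * M ^ 2 :=
    le_mul_of_one_le_right (abs_nonneg _) (one_le_pow₀ hM1)
  have hc : Continuous fun x : ℝ => c₃ * x ^ 3 + c₂ * x ^ 2 + c₁ * x + c₀ := by fun_prop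
  have hlo : c₃ * (-M) ^ 3 + c₂ * (-M) ^ 2 + c₁ * (-M) + c₀ ≤ 0 := by
    have e1 := le_abs_self (c₂ * M ^ 2)
    have e2 := neg_abs_le (c₁ * M)
    have e3 := le_abs_self c₀
    nlinarith
  have hhi : 0 ≤ c₃ * M ^ 3 + c₂ * M ^ 2 + c₁ * M + c₀ := by
    have e1 := neg_abs_le (c₂ * M ^ 2)
    have e2 := neg_abs_le (c₁ * M)
    have e3 := neg_abs_le c₀
    nlinarith
  obtain ⟨x, -, hx⟩ := intermediate_value_Icc (by linarith : -M ≤ M) hc.continuousOn ⟨hlo, hhi⟩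
  exact ⟨x, hx⟩

/-- In these coordinates `Ax + By` becomes `(A² + B²) ξ`. For each fixed `η` a cubic in `ξ` with
positive leading coefficient remains, which has a real root. -/
theorem cubicAt_rotated (A B S H K ξ η : ℝ) :
    cubicAt A B S H K ⟨A * ξ - B * η, B * ξ + A * η⟩ =
      (A ^ 2 + B ^ 2) ^ 2 * ξ ^ 3 + (A ^ 2 + B ^ 2) * S * ξ ^ 2
        + ((A ^ 2 + B ^ 2) ^ 2 * η ^ 2 + (H * A + K * B)) * ξ
        + ((A ^ 2 + B ^ 2) * S * η ^ 2 + (K * A - H * B) * η) := by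
  simp only [cubicAt]
  ring

theorem sq_add_sq_pos_of_ne {A B : ℝ} (h : (A, B) ≠ (0, 0)) : 0 < A ^ 2 + B ^ 2 := by
  by_contra! h0
  apply h
  have hA : A = 0 := by nlinarith [sq_nonneg A, sq_nonneg B]
  have hB : B = 0 := by nlinarith [sq_nonneg A, sq_nonneg B]
  rw [hA, hB]

theorem exists_quadrilateral {A B S H K : ℝ} (hAB : (A, B) ≠ (0, 0)) (hHK : (H, K) ≠ (0, 0))
    (P : ℂ) : ∃ a b c d : ℂ, [a, b, c, d].Nodup ∧ b + d - a - c = ⟨-B, A⟩ ∧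
      ∀ X, isogonalForm a b c d X = cubicAt A B S H K (X - P) := by
  have hN := sq_add_sq_pos_of_ne hAB
  set δ : ℂ := ⟨-B, A⟩ with hδ
  have hδ0 : δ ≠ 0 := by
    intro h
    apply hAB
    have h1 := congrArg Complex.re h
    have h2 := congrArg Complex.im h
    simp [hδ] at h1 h2
    rw [h1, h2]
  have hδ0' : conj δ ≠ 0 := by simpa using hδ0
  -- Comparing with `isogonalForm_eq_cubicAt`: `m * conj δ` must be `K - iH`, and `Im (s * conj δ)`
  -- must be `S`, which leaves `s` free along a line of direction `δ`.
  obtain ⟨m, hm⟩ : ∃ m : ℂ, m * conj δ = ⟨K, -H⟩ := ⟨⟨K, -H⟩ / conj δ, div_mul_cancel₀ _ hδ0'⟩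
  have hm0 : m ≠ 0 := by
    rintro rfl
    apply hHK
    have h1 := congrArg Complex.re hm
    have h2 := congrArg Complex.im hm
    simp at h1 h2
    rw [← h1, h2]
  -- the sum of one pair of opposite vertices lies on a line, whose points are all but finitely
  -- many suitable
  obtain ⟨s₀, hs₀⟩ : ∃ s₀ : ℂ, (s₀ * conj δ).im = S := by
    refine ⟨⟨0, S⟩ / conj δ, ?_⟩
    rw [div_mul_cancel₀ _ hδ0']
  -- The discriminant `s² - 4m` vanishes at `s = ±r`. The excluded values are those giving `a = c`
  -- or `b = d`.
  obtain ⟨r, hr⟩ := IsAlgClosed.exists_pow_nat_eq (4 * m) (n := 2) two_pos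
  let bad : Set ℂ := {r, -r, r - δ, -r - δ}
  have hfin : ((fun x : ℝ => s₀ + x * δ) ⁻¹' bad).Finite := by
    apply Set.Finite.preimage
    · intro x _ y _ hxy
      simpa [hδ0] using hxy
    · simp [bad]
  obtain ⟨x, hx⟩ := hfin.infinite_compl.nonempty
  obtain ⟨s, hs⟩ : ∃ s : ℂ, s = s₀ + x * δ := ⟨_, rfl⟩
  simp only [Set.mem_compl_iff, Set.mem_preimage, ← hs, bad, Set.mem_insert_iff,
    Set.mem_singleton_iff, not_or] at hx
  obtain ⟨hx1, hx2, hx3, hx4⟩ := hx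
  have hsS : (s * conj δ).im = S := by
    rw [hs, add_mul, mul_assoc, Complex.mul_conj, Complex.add_im, hs₀]
    simp
  have hroots : ∀ t : ℂ, t ≠ r → t ≠ -r → ∃ u v : ℂ, u ≠ v ∧ u + v = t ∧ u * v = m := by
    intro t h1 h2
    obtain ⟨w, hw⟩ := IsAlgClosed.exists_pow_nat_eq (t ^ 2 - 4 * m) (n := 2) two_pos
    refine ⟨(t + w) / 2, (t - w) / 2, ?_, by ring, by linear_combination -hw / 4⟩
    intro h
    have hw0 : w = 0 := by linear_combination h
    rw [hw0, ← hr] at hw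
    have : (t - r) * (t + r) = 0 := by linear_combination -hw
    rcases mul_eq_zero.1 this with h | h
    · exact h1 (sub_eq_zero.1 h)
    · exact h2 (eq_neg_of_add_eq_zero_left h)
  obtain ⟨a, c, hac, hac1, hac2⟩ := hroots s hx1 hx2
  obtain ⟨b, d, hbd, hbd1, hbd2⟩ := hroots (s + δ) (fun h => hx3 (by rw [← h]; ring))
    (fun h => hx4 (by rw [← h]; ring))
  -- A common root of the two quadratics satisfies `u * δ = 0`, so `u = 0` and then `m = 0`.
  have hne : ∀ u u' v v' : ℂ, u + u' = s → u * u' = m → v + v' = s + δ → v * v' = m → u ≠ v := by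
    rintro u u' v v' h1 h2 h3 h4 rfl
    have : u * δ = 0 := by linear_combination u * h1 - h2 - u * h3 + h4
    rcases mul_eq_zero.1 this with h | h
    · rw [h, zero_mul] at h2
      exact hm0 h2.symm
    · exact hδ0 h
  have hca1 : c + a = s := by rw [add_comm, hac1]
  have hca2 : c * a = m := by rw [mul_comm, hac2]
  have hdb1 : d + b = s + δ := by rw [add_comm, hbd1]
  have hdb2 : d * b = m := by rw [mul_comm, hbd2]
  have hsum : P + b + (P + d) - (P + a) - (P + c) = δ := by linear_combination hbd1 - hac1
  refine ⟨P + a, P + b, P + c, P + d, ?_, hsum, fun X => ?_⟩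
  · simp only [List.nodup_cons, List.mem_cons, List.not_mem_nil, or_false, not_or,
      not_false_eq_true, List.nodup_nil, and_true, add_right_inj]
    exact ⟨⟨hne _ _ _ _ hac1 hac2 hbd1 hbd2, hac, hne _ _ _ _ hac1 hac2 hdb1 hdb2⟩,
      ⟨(hne _ _ _ _ hca1 hca2 hbd1 hbd2).symm, hbd⟩, hne _ _ _ _ hca1 hca2 hdb1 hdb2⟩
  · rw [isogonalForm_eq_cubicAt (P := P) (by linear_combination hac2 - hbd2), hsum]
    have e1 : P + a + (P + c) - 2 * P = s := by linear_combination hac1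
    have e2 : P + b + (P + d) - 2 * P = s + δ := by linear_combination hbd1
    have e3 : (P + a - P) * (P + c - P) = m := by linear_combination hac2
    rw [e1, e2, e3, hm, map_add, mul_add, Complex.mul_conj, Complex.add_im, hsS]
    simp [hδ]

/-! ### The equation `f(x, y) = f(p, q)` and its center. -/

theorem evalAt_form (A B C D E F G : ℝ) (X : ℂ) :
    evalAt (form A B C D E F G) X = A * X.re ^ 3 + B * (X.re ^ 2 * X.im) + A * (X.re * X.im ^ 2)
      + B * X.im ^ 3 + C * X.re ^ 2 + D * (X.re * X.im) + E * X.im ^ 2 + F * X.re + G * X.im := by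
  simp [evalAt, form, MvPolynomial.smul_eval]

theorem eq_of_evalAt_eq {p q : MvPolynomial (Fin 2) ℝ} (h : ∀ X, evalAt p X = evalAt q X) :
    p = q := by
  refine MvPolynomial.funext fun z => ?_
  have hz : z = ![z 0, z 1] := by ext i; fin_cases i <;> rfl
  rw [hz]
  exact h ⟨z 0, z 1⟩

theorem HasForm.evalAt_eq_cubicAt {φ : MvPolynomial (Fin 2) ℝ} {A B C D E F G : ℝ}
    (hAB : (A, B) ≠ (0, 0)) (h : HasForm φ A B C D E F G) :
    ∃ S H K : ℝ, (A ^ 2 + B ^ 2) * (S - A * (center A B C D E).re - B * (center A B C D E).im) =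
        A ^ 2 * E - A * B * D + B ^ 2 * C ∧
      ∀ X, evalAt φ X = cubicAt A B S H K (X - center A B C D E) := by
  have hN := (sq_add_sq_pos_of_ne hAB).ne'
  have hp : 2 * (A ^ 2 + B ^ 2) * (center A B C D E).re = A * E - A * C - B * D :=
    mul_div_cancel₀ _ (mul_ne_zero two_ne_zero hN)
  have hq : 2 * (A ^ 2 + B ^ 2) * (center A B C D E).im = B * C - A * D - B * E :=
    mul_div_cancel₀ _ (mul_ne_zero two_ne_zero hN)
  rw [HasForm] at h
  obtain ⟨P, hP⟩ : ∃ P, P = center A B C D E := ⟨_, rfl⟩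
  rw [← hP] at hp hq h ⊢
  -- `h1` and `h2` say that after moving the origin to `P` the coefficients of `x²` and `y²` agree
  -- and that of `xy` vanishes.
  have h1 : 2 * (A * P.re - B * P.im) = E - C := by
    apply mul_left_cancel₀ hN
    linear_combination A * hp - B * hq
  have h2 : 2 * (B * P.re + A * P.im) = -D := by
    apply mul_left_cancel₀ hN
    linear_combination B * hp + A * hq
  -- `S` is the common coefficient of `x²` and `y²` at `P`; `(H, K)` is the gradient of `f` there.
  refine ⟨3 * A * P.re + B * P.im + C,
    3 * A * P.re ^ 2 + 2 * B * P.re * P.im + A * P.im ^ 2 + 2 * C * P.re + D * P.im + F,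
    B * P.re ^ 2 + 2 * A * P.re * P.im + 3 * B * P.im ^ 2 + D * P.re + 2 * E * P.im + G,
    by linear_combination A * hp, fun X => ?_⟩
  have e : evalAt φ X = evalAt (form A B C D E F G) X - evalAt (form A B C D E F G) P := by
    rw [h]
    simp [evalAt]
  rw [e, evalAt_form, evalAt_form]
  simp only [cubicAt, Complex.sub_re, Complex.sub_im]
  linear_combination (-(X.im - P.im) ^ 2) * h1 + (X.re - P.re) * (X.im - P.im) * h2

theorem exists_hasForm {A B S H K : ℝ} {P : ℂ} (hAB : (A, B) ≠ (0, 0)) :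
    ∃ C D E F G : ℝ, ∀ X, evalAt (form A B C D E F G
      - MvPolynomial.C (evalAt (form A B C D E F G) (center A B C D E))) X
        = cubicAt A B S H K (X - P) := by
  have hN := (sq_add_sq_pos_of_ne hAB).ne'
  set l := S - A * P.re - B * P.im with hl
  have hc : center A B (l - 2 * A * P.re) (-2 * B * P.re - 2 * A * P.im) (l - 2 * B * P.im) = P := by
    apply Complex.ext
    · simp only [center]
      field_simp
      ring
    · simp only [center]
      field_simp
      ring
  refine ⟨l - 2 * A * P.re, -2 * B * P.re - 2 * A * P.im, l - 2 * B * P.im,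
    (P.re ^ 2 + P.im ^ 2) * A - 2 * P.re * l + H, (P.re ^ 2 + P.im ^ 2) * B - 2 * P.im * l + K,
    fun X => ?_⟩
  rw [hc]
  have e : ∀ (f : MvPolynomial (Fin 2) ℝ) (r : ℝ), evalAt (f - MvPolynomial.C r) X
      = evalAt f X - r := fun f r => by simp [evalAt]
  rw [e, evalAt_form, evalAt_form]
  simp only [cubicAt, Complex.sub_re, Complex.sub_im, hl]
  ring

/-- A shift by `w` adds to the quadratic part a difference of `x²` and `y²` coefficients and an `xy`
coefficient that are linear in `w` with determinant a multiple of `A² + B²`; both must vanish, so `w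
= 0`. -/
theorem cubicAt_shift_injective {A B S H K A' B' S' H' K' : ℝ} {P P' : ℂ} (hAB : (A, B) ≠ (0, 0))
    (h : ∀ X, cubicAt A B S H K (X - P) = cubicAt A' B' S' H' K' (X - P')) : P = P' := by
  obtain ⟨w, hw⟩ : ∃ w, w = P - P' := ⟨_, rfl⟩
  have h' : ∀ x y : ℝ, cubicAt A B S H K ⟨x, y⟩ = cubicAt A' B' S' H' K' ⟨x + w.re, y + w.im⟩ := by
    intro x y
    have := h (⟨x, y⟩ + P)
    rw [add_sub_cancel_right] at this
    rw [this]
    congr 1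
    rw [hw]
    apply Complex.ext <;> simp <;> ring
  simp only [cubicAt] at h'
  -- Finite differences of these values isolate the coefficients.
  have e00 := h' 0 0
  have e10 := h' 1 0
  have e20 := h' 2 0
  have e11 := h' (-1) 0
  have f10 := h' 0 1
  have f11 := h' 0 (-1)
  have f20 := h' 0 2
  have g1 := h' 1 1
  have g2 := h' 1 (-1)
  have hA : A = A' := by linear_combination (e20 - 3 * e10 + 3 * e00 - e11) / 6
  have hB : B = B' := by linear_combination (f20 - 3 * f10 + 3 * e00 - f11) / 6
  subst hA hB
  have h1 : A * w.re - B * w.im = 0 := by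
    linear_combination (-(e10 + e11) + (f10 + f11)) / 4
  have h2 : B * w.re + A * w.im = 0 := by
    linear_combination (-(g1 - e10 - f10 + e00) + (g2 - e10 - f11 + e00)) / 4
  have hN := (sq_add_sq_pos_of_ne hAB).ne'
  have h3 : w.re = 0 := by
    apply mul_left_cancel₀ hN
    linear_combination A * h1 + B * h2
  have h4 : w.im = 0 := by
    apply mul_left_cancel₀ hN
    linear_combination A * h2 - B * h1
  exact sub_eq_zero.1 (hw ▸ Complex.ext h3 h4)

theorem HasForm.evalAt_homogeneousComponent {φ : MvPolynomial (Fin 2) ℝ} {A B C D E F G : ℝ}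
    (h : HasForm φ A B C D E F G) (v : ℂ) :
    evalAt (MvPolynomial.homogeneousComponent 3 φ) v =
      (v.re ^ 2 + v.im ^ 2) * (A * v.re + B * v.im) := by
  have hX : ∀ i : Fin 2, (MvPolynomial.X i : MvPolynomial (Fin 2) ℝ).IsHomogeneous 1 :=
    fun i => MvPolynomial.isHomogeneous_X ℝ i
  have hz : ∀ {n : ℕ} {p : MvPolynomial (Fin 2) ℝ}, p.IsHomogeneous n →
      MvPolynomial.homogeneousComponent 3 p = if 3 = n then p else 0 :=
    fun hp => MvPolynomial.homogeneousComponent_of_mem hp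
  rw [h, form]
  simp only [map_add, map_sub, map_smul, hz ((hX 0).pow 3), hz ((hX 1).pow 3),
    hz (((hX 0).pow 2).mul (hX 1)), hz ((hX 0).mul ((hX 1).pow 2)), hz ((hX 0).pow 2),
    hz ((hX 1).pow 2), hz ((hX 0).mul (hX 1)), hz (hX 0), hz (hX 1),
    hz (MvPolynomial.isHomogeneous_C (Fin 2) _)]
  simp [evalAt, MvPolynomial.smul_eval]
  ring

/-! ### From the real curve back to its equation. -/

/-- With `H = K = 0` the cubic splits into `x² + y²` and a line, centered at `P`. Each factor has a
real zero (`P`, and the foot of the perpendicular from `P`), so neither is a unit. -/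
theorem not_irreducible_of_evalAt_eq {φ : MvPolynomial (Fin 2) ℝ} {A B S : ℝ} {P : ℂ}
    (hAB : (A, B) ≠ (0, 0)) (h : ∀ X, evalAt φ X = cubicAt A B S 0 0 (X - P)) :
    ¬ Irreducible φ := by
  intro hirr
  have hN := (sq_add_sq_pos_of_ne hAB).ne'
  let u : MvPolynomial (Fin 2) ℝ := MvPolynomial.X 0 - MvPolynomial.C P.re
  let v : MvPolynomial (Fin 2) ℝ := MvPolynomial.X 1 - MvPolynomial.C P.im
  have hφ : φ = (u ^ 2 + v ^ 2) * (A • u + B • v + MvPolynomial.C S) := by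
    refine eq_of_evalAt_eq fun X => ?_
    rw [h]
    simp [evalAt, u, v, cubicAt, MvPolynomial.smul_eval]
  have hnu : ∀ {p : MvPolynomial (Fin 2) ℝ} (X : ℂ), evalAt p X = 0 → ¬ IsUnit p := by
    intro p X hX hp
    have := hp.map (MvPolynomial.eval ![X.re, X.im])
    exact this.ne_zero hX
  rcases hirr.isUnit_or_isUnit hφ with h1 | h1
  · exact hnu P (by simp [evalAt, u, v]) h1
  · refine hnu ⟨P.re - A * S / (A ^ 2 + B ^ 2), P.im - B * S / (A ^ 2 + B ^ 2)⟩ ?_ h1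
    simp [evalAt, u, v, MvPolynomial.smul_eval]
    field_simp
    ring

theorem totalDegree_form_le (A B C D E F G r : ℝ) :
    (form A B C D E F G - MvPolynomial.C r).totalDegree ≤ 3 := by
  rw [← MvPolynomial.mem_restrictTotalDegree]
  have hX : ∀ i : Fin 2, (MvPolynomial.X i : MvPolynomial (Fin 2) ℝ).IsHomogeneous 1 :=
    fun i => MvPolynomial.isHomogeneous_X ℝ i
  have hz : ∀ {n : ℕ} {p : MvPolynomial (Fin 2) ℝ}, n ≤ 3 → p.IsHomogeneous n →
      p ∈ MvPolynomial.restrictTotalDegree (Fin 2) ℝ 3 := fun hn hp =>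
    (MvPolynomial.mem_restrictTotalDegree _ _ _).2 (hp.totalDegree_le.trans hn)
  have hs : ∀ {n : ℕ} {p : MvPolynomial (Fin 2) ℝ} (c : ℝ), n ≤ 3 → p.IsHomogeneous n →
      c • p ∈ MvPolynomial.restrictTotalDegree (Fin 2) ℝ 3 := fun c hn hp =>
    Submodule.smul_mem _ c (hz hn hp)
  refine Submodule.sub_mem _ ?_ (hz (by norm_num) (MvPolynomial.isHomogeneous_C (Fin 2) r))
  unfold form
  refine Submodule.add_mem _ (Submodule.add_mem _ (Submodule.add_mem _ (Submodule.add_mem _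
    (Submodule.add_mem _ (Submodule.add_mem _ (Submodule.add_mem _ (Submodule.add_mem _
      (hs _ ?_ ((hX 0).pow 3)) (hs _ ?_ (((hX 0).pow 2).mul (hX 1))))
      (hs _ ?_ ((hX 0).mul ((hX 1).pow 2)))) (hs _ ?_ ((hX 1).pow 3))) (hs _ ?_ ((hX 0).pow 2)))
      (hs _ ?_ ((hX 0).mul (hX 1)))) (hs _ ?_ ((hX 1).pow 2))) (hs _ ?_ (hX 0))) (hs _ ?_ (hX 1))
    <;> norm_num

/-- The substitution of an orientation-preserving similarity into polynomials. -/
theorem exists_similarity_algEquiv {A B : ℝ} (hAB : (A, B) ≠ (0, 0)) (P : ℂ) :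
    ∃ e : MvPolynomial (Fin 2) ℝ ≃ₐ[ℝ] MvPolynomial (Fin 2) ℝ, ∀ f x y,
      MvPolynomial.eval ![x, y] (e f) = evalAt f (P + ⟨A * x - B * y, B * x + A * y⟩) := by
  have hN := (sq_add_sq_pos_of_ne hAB).ne'
  open MvPolynomial in
  let g : MvPolynomial (Fin 2) ℝ →ₐ[ℝ] MvPolynomial (Fin 2) ℝ :=
    aeval ![C P.re + C A * X 0 - C B * X 1, C P.im + C B * X 0 + C A * X 1]
  open MvPolynomial in
  let g' : MvPolynomial (Fin 2) ℝ →ₐ[ℝ] MvPolynomial (Fin 2) ℝ :=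
    aeval ![C (A ^ 2 + B ^ 2)⁻¹ * (C A * (X 0 - C P.re) + C B * (X 1 - C P.im)),
      C (A ^ 2 + B ^ 2)⁻¹ * (C A * (X 1 - C P.im) - C B * (X 0 - C P.re))]
  have hg : ∀ f x y, MvPolynomial.eval ![x, y] (g f)
      = evalAt f (P + ⟨A * x - B * y, B * x + A * y⟩) := by
    intro f x y
    simp only [g, evalAt]
    rw [← MvPolynomial.coe_aeval_eq_eval, ← MvPolynomial.coe_aeval_eq_eval]
    simp only [RingHom.coe_coe]
    rw [← AlgHom.comp_apply, MvPolynomial.comp_aeval]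
    congr 2
    ext i
    fin_cases i
    · simp
      ring
    · simp
      ring
  refine ⟨AlgEquiv.ofAlgHom g g' ?_ ?_, hg⟩
  · refine MvPolynomial.algHom_ext fun i => MvPolynomial.funext fun z => ?_
    fin_cases i
    · simp [g, g']
      field_simp
      ring
    · simp [g, g']
      field_simp
      ring
  · refine MvPolynomial.algHom_ext fun i => MvPolynomial.funext fun z => ?_
    fin_cases i
    · simp [g, g']
      field_simp
      ring
    · simp [g, g']
      field_simp
      ring

theorem exists_eq_mul_evalAt {φ : MvPolynomial (Fin 2) ℝ} (hdeg : φ.totalDegree = 3)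
    (hirr : Irreducible φ) {A B S H K : ℝ} {P : ℂ} (hAB : (A, B) ≠ (0, 0))
    (h : ∀ X, cubicAt A B S H K (X - P) = 0 → evalAt φ X = 0) :
    ∃ k : ℝ, k ≠ 0 ∧ ∀ X, cubicAt A B S H K (X - P) = k * evalAt φ X := by
  obtain ⟨C, D, E, F, G, hQ⟩ := exists_hasForm (S := S) (H := H) (K := K) (P := P) hAB
  set Q := form A B C D E F G
      - MvPolynomial.C (evalAt (form A B C D E F G) (center A B C D E)) with hQdef
  have hN := sq_add_sq_pos_of_ne hAB
  have hQ0 : Q ≠ 0 := by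
    intro h0
    have h1 : MvPolynomial.homogeneousComponent 3 Q = 0 := by rw [h0, map_zero]
    have h2 := HasForm.evalAt_homogeneousComponent hQdef ⟨A, B⟩
    rw [h1] at h2
    simp only [evalAt, map_zero] at h2
    have h3 : 0 < (A ^ 2 + B ^ 2) * (A * A + B * B) := by
      have : 0 < A * A + B * B := by nlinarith
      positivity
    linarith
  -- After the similarity, each line `y = const` carries a zero of `Q`, which is also one of `φ`.
  obtain ⟨e, he⟩ := exists_similarity_algEquiv hAB P
  have hdvd : φ ∣ Q := by
    rw [← map_dvd_iff e]
    refine dvd_of_common_zeros ((MulEquiv.irreducible_iff e).2 hirr) fun y => ?_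
    obtain ⟨x, hx⟩ := exists_root_cubic (pow_pos hN 2) ((A ^ 2 + B ^ 2) * S)
      ((A ^ 2 + B ^ 2) ^ 2 * y ^ 2 + (H * A + K * B))
      ((A ^ 2 + B ^ 2) * S * y ^ 2 + (K * A - H * B) * y)
    rw [← cubicAt_rotated] at hx
    refine ⟨x, ?_, ?_⟩
    · rw [he]
      apply h
      rwa [add_sub_cancel_left]
    · rw [he, hQ]
      rwa [add_sub_cancel_left]
  obtain ⟨R, hR⟩ := hdvd
  have hR0 : R ≠ 0 := by
    rintro rfl
    rw [mul_zero] at hR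
    exact hQ0 hR
  have hRdeg : R.totalDegree = 0 := by
    have h1 := totalDegree_form_le A B C D E F G (evalAt (form A B C D E F G) (center A B C D E))
    rw [← hQdef, hR, MvPolynomial.totalDegree_mul_of_isDomain hirr.ne_zero hR0, hdeg] at h1
    lia
  rw [MvPolynomial.totalDegree_eq_zero_iff_eq_C] at hRdeg
  refine ⟨R.coeff 0, fun h0 => hR0 (by rw [hRdeg, h0, map_zero]), fun X => ?_⟩
  rw [← hQ, hR, hRdeg]
  simp [evalAt, mul_comm]

/-! ### The asymptote. -/

/-- The path stays close to points `Q + s u` of `ℓ` with `|s| → ∞`, so `L Q + r + s * L u → 0`. This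
forces `L u = 0` and then `L Q + r = 0`. -/
theorem isAsymptote_line_unique {S : Set ℂ} {L : ℂ →L[ℝ] ℝ} {r : ℝ} (hL : L ≠ 0)
    (hS : ∀ ε > 0, ∃ R, ∀ X ∈ S, R ≤ ‖X‖ → |L X + r| ≤ ε) {ℓ : AffineSubspace ℝ ℂ}
    (h : IsAsymptote S ℓ) : (ℓ : Set ℂ) = {X | L X + r = 0} := by
  obtain ⟨hdim, γ, -, hγS, hγ, hdist⟩ := h
  have hne : (ℓ : Set ℂ).Nonempty := by
    rw [Set.nonempty_iff_ne_empty]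
    intro h0
    rw [AffineSubspace.coe_eq_bot_iff] at h0
    rw [h0, AffineSubspace.direction_bot, finrank_bot] at hdim
    exact zero_ne_one hdim
  obtain ⟨Q, hQ⟩ := hne
  obtain ⟨u, hu0, hu⟩ := finrank_eq_one_iff'.1 hdim
  have hmem : ∀ X, X ∈ ℓ ↔ ∃ t : ℝ, X = Q + t • (u : ℂ) := by
    intro X
    constructor
    · intro hX
      obtain ⟨t, ht⟩ := hu ⟨X - Q, AffineSubspace.vsub_mem_direction hX hQ⟩
      refine ⟨t, ?_⟩
      have := congrArg Subtype.val ht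
      simp only [Submodule.coe_smul] at this
      rw [this]
      ring
    · rintro ⟨t, rfl⟩
      rw [add_comm]
      exact AffineSubspace.vadd_mem_of_mem_direction (Submodule.smul_mem _ t u.2) hQ
  have hu0' : (u : ℂ) ≠ 0 := by simpa using hu0
  have hLγ : Tendsto (fun t => L (γ t) + r) atTop (𝓝 0) := by
    rw [Metric.tendsto_atTop']
    intro ε hε
    obtain ⟨R, hR⟩ := hS (ε / 2) (half_pos hε)
    obtain ⟨T, hT⟩ := eventually_atTop.1 (hγ.eventually_ge_atTop R)
    refine ⟨T, fun t ht => ?_⟩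
    have := hR _ (hγS t) (hT t ht.le)
    rw [Real.dist_0_eq_abs]
    linarith
  have hnear : ∀ t : ℝ, ∃ s : ℝ, dist (γ t) (Q + s • (u : ℂ)) <
      Metric.infDist (γ t) (ℓ : Set ℂ) + Real.exp (-t) := by
    intro t
    obtain ⟨y, hy, hlt⟩ := (Metric.infDist_lt_iff ⟨Q, hQ⟩).1
      (lt_add_of_pos_right (Metric.infDist (γ t) (ℓ : Set ℂ)) (Real.exp_pos (-t)))
    obtain ⟨s, rfl⟩ := (hmem y).1 hy
    exact ⟨s, hlt⟩
  choose s hs using hnear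
  have hd0 : Tendsto (fun t => dist (γ t) (Q + s t • (u : ℂ))) atTop (𝓝 0) := by
    refine squeeze_zero (fun _ => dist_nonneg) (fun t => (hs t).le) ?_
    simpa using hdist.add Real.tendsto_exp_neg_atTop_nhds_zero
  have hd0' : Tendsto (fun t => γ t - (Q + s t • (u : ℂ))) atTop (𝓝 0) := by
    rw [tendsto_zero_iff_norm_tendsto_zero]
    simpa [dist_eq_norm] using hd0
  have hLs : Tendsto (fun t => (L Q + r) + s t * L u) atTop (𝓝 0) := by
    have h1 := hLγ.sub ((L.continuous.tendsto 0).comp hd0')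
    rw [map_zero, sub_zero] at h1
    refine h1.congr fun t => ?_
    simp only [Function.comp, map_sub, map_add, map_smul, smul_eq_mul]
    ring
  have hs_top : Tendsto (fun t => |s t|) atTop atTop := by
    have h1 : Tendsto (fun t => ‖γ t‖ + (-‖γ t - (Q + s t • (u : ℂ))‖ - ‖Q‖)) atTop atTop := by
      refine hγ.atTop_add (C := -0 - ‖Q‖) ?_
      have := (hd0'.norm.neg).sub_const ‖Q‖
      simpa using this
    have h2 : Tendsto (fun t => |s t| * ‖(u : ℂ)‖) atTop atTop := by
      refine tendsto_atTop_mono (fun t => ?_) h1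
      have e : γ t = (γ t - (Q + s t • (u : ℂ))) + Q + s t • (u : ℂ) := by ring
      have := norm_add₃_le (a := γ t - (Q + s t • (u : ℂ))) (b := Q) (c := s t • (u : ℂ))
      rw [← e, norm_smul, Real.norm_eq_abs] at this
      linarith
    have hu1 : 0 < ‖(u : ℂ)‖ := norm_pos_iff.2 hu0'
    have h3 := h2.atTop_mul_const (inv_pos.2 hu1)
    refine h3.congr fun t => ?_
    rw [mul_assoc, mul_inv_cancel₀ hu1.ne', mul_one]
  have hLu : L u = 0 := by
    by_contra hne
    have h1 : Tendsto (fun t => |s t * L u|) atTop atTop := by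
      simp only [abs_mul]
      exact hs_top.atTop_mul_const (abs_pos.2 hne)
    have h2 : Tendsto (fun t => |s t * L u|) atTop (𝓝 |0 - (L Q + r)|) := by
      refine ((hLs.sub_const (L Q + r)).abs).congr fun t => ?_
      rw [add_sub_cancel_left]
    exact not_tendsto_nhds_of_tendsto_atTop h1 _ h2
  have hLQ : L Q + r = 0 := by
    simp only [hLu, mul_zero, add_zero] at hLs
    exact tendsto_nhds_unique tendsto_const_nhds hLs
  have hker : ∀ z : ℂ, L z = 0 → ∃ t : ℝ, z = t • (u : ℂ) := by
    intro z hz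
    by_contra! hcon
    apply hL
    have hzu : (z * conj (u : ℂ)).im ≠ 0 := by
      intro h0
      obtain ⟨t, ht⟩ := Submodule.mem_span_singleton.1 ((mem_span_singleton_iff hu0').2 h0)
      exact hcon t ht.symm
    -- Cramer's rule: if `z` and `u` were independent zeros of `L`, they would span the plane and
    -- `L` would vanish.
    have key : ∀ w : ℂ, (z * conj (u : ℂ)).im • w
        = (w * conj (u : ℂ)).im • z - (w * conj z).im • (u : ℂ) := by
      intro w
      apply Complex.ext <;> simp [Complex.mul_im, Complex.mul_re] <;> ring
    ext w
    have h1 := congrArg L (key w)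
    simp only [map_sub, map_smul, hz, hLu, smul_eq_mul, mul_zero, sub_zero] at h1
    exact (mul_eq_zero.1 h1).resolve_left hzu
  ext X
  rw [SetLike.mem_coe, hmem, Set.mem_ofPred_eq]
  constructor
  · rintro ⟨t, rfl⟩
    rw [map_add, map_smul, hLu, smul_zero, add_zero, hLQ]
  · intro hX
    obtain ⟨t, ht⟩ := hker (X - Q) (by rw [map_sub]; linarith)
    exact ⟨t, by rw [← ht]; ring⟩

/-- The function `Z ↦ A x + B y`. -/
noncomputable def linearPart (A B : ℝ) : ℂ →L[ℝ] ℝ := A • Complex.reCLM + B • Complex.imCLM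

theorem linearPart_apply (A B : ℝ) (Z : ℂ) : linearPart A B Z = A * Z.re + B * Z.im := by
  simp [linearPart]

theorem linearPart_ne_zero {A B : ℝ} (hAB : (A, B) ≠ (0, 0)) : linearPart A B ≠ 0 := by
  intro h
  apply hAB
  have h1 := DFunLike.congr_fun h 1
  have h2 := DFunLike.congr_fun h Complex.I
  simp [linearPart_apply] at h1 h2
  rw [h1, h2]

theorem cubicAt_abs_linear_le (A B S H K : ℝ) {ε : ℝ} (hε : 0 < ε) :
    ∃ R, ∀ Z, cubicAt A B S H K Z = 0 → R ≤ ‖Z‖ → |linearPart A B Z + S| ≤ ε := by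
  refine ⟨(|H| + |K|) / ε + 1, fun Z hZ hR => ?_⟩
  have hn : 0 < ‖Z‖ := lt_of_lt_of_le (by positivity) hR
  rw [linearPart_apply]
  have h1 : ‖Z‖ ^ 2 * (A * Z.re + B * Z.im + S) = -(H * Z.re + K * Z.im) := by
    rw [Complex.sq_norm, Complex.normSq_apply]
    simp only [cubicAt] at hZ
    linear_combination hZ
  have h2 : ‖Z‖ ^ 2 * |A * Z.re + B * Z.im + S| ≤ (|H| + |K|) * ‖Z‖ := by
    have e : ‖Z‖ ^ 2 * |A * Z.re + B * Z.im + S| = |H * Z.re + K * Z.im| := by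
      rw [← abs_neg (H * Z.re + K * Z.im), ← h1, abs_mul, abs_of_nonneg (sq_nonneg ‖Z‖)]
    rw [e]
    calc |H * Z.re + K * Z.im| ≤ |H * Z.re| + |K * Z.im| := abs_add_le _ _
      _ = |H| * |Z.re| + |K| * |Z.im| := by rw [abs_mul, abs_mul]
      _ ≤ |H| * ‖Z‖ + |K| * ‖Z‖ := by
        gcongr
        · exact Complex.abs_re_le_norm Z
        · exact Complex.abs_im_le_norm Z
      _ = (|H| + |K|) * ‖Z‖ := by ring
  have h3 : ‖Z‖ * |A * Z.re + B * Z.im + S| ≤ |H| + |K| := by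
    apply le_of_mul_le_mul_left _ hn
    linarith
  have h4 : |H| + |K| ≤ ε * ‖Z‖ := by
    have : (|H| + |K|) / ε ≤ ‖Z‖ := by linarith
    rw [div_le_iff₀ hε] at this
    linarith
  apply le_of_mul_le_mul_left _ hn
  linarith

/-- The sign of `g a` at `y₀` persists nearby, and monotonicity turns it into a bound on the root.
-/
theorem continuousOn_of_strictMono_root {g : ℝ → ℝ → ℝ} {ξ : ℝ → ℝ} {s : Set ℝ}
    (hg : ∀ x, Continuous fun y => g x y) (hmono : ∀ y ∈ s, StrictMono fun x => g x y)
    (hξ : ∀ y ∈ s, g (ξ y) y = 0) : ContinuousOn ξ s := by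
  intro y₀ hy₀
  refine tendsto_order.2 ⟨fun a ha => ?_, fun a ha => ?_⟩
  · have h1 : g a y₀ < 0 := by rw [← hξ y₀ hy₀]; exact hmono y₀ hy₀ ha
    have h2 : ∀ᶠ y in 𝓝[s] y₀, g a y < 0 :=
      ((hg a).continuousWithinAt (s := s) (x := y₀)).eventually_lt_const h1
    filter_upwards [h2, self_mem_nhdsWithin] with y hy hys
    exact (hmono y hys).lt_iff_lt.1 (by simpa only [hξ y hys] using hy)
  · have h1 : 0 < g a y₀ := by rw [← hξ y₀ hy₀]; exact hmono y₀ hy₀ ha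
    have h2 : ∀ᶠ y in 𝓝[s] y₀, 0 < g a y :=
      ((hg a).continuousWithinAt (s := s) (x := y₀)).eventually_const_lt h1
    filter_upwards [h2, self_mem_nhdsWithin] with y hy hys
    exact (hmono y hys).lt_iff_lt.1 (by simpa only [hξ y hys] using hy)

theorem exists_path {A B S H K : ℝ} (hAB : (A, B) ≠ (0, 0)) :
    ∃ γ : ℝ → ℂ, Continuous γ ∧ (∀ t, cubicAt A B S H K (γ t) = 0) ∧
      Tendsto (fun t => ‖γ t‖) atTop atTop := by
  have hN := sq_add_sq_pos_of_ne hAB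
  set N := A ^ 2 + B ^ 2 with hNdef
  let g : ℝ → ℝ → ℝ := fun x y => N ^ 2 * x ^ 3 + N * S * x ^ 2
    + (N ^ 2 * y ^ 2 + (H * A + K * B)) * x + (N * S * y ^ 2 + (K * A - H * B) * y)
  have hroot : ∀ y, ∃ x, g x y = 0 := fun y => exists_root_cubic (pow_pos hN 2) _ _ _
  choose ξ hξ using hroot
  -- Beyond `T` the difference quotient of `g` in `x` is positive, by completing the square in `N
  -- (x₁ + x₂)`; hence the root is unique and varies continuously.
  obtain ⟨T, hT0, hT⟩ : ∃ T : ℝ, 0 ≤ T ∧ ∀ y, T ≤ y → S ^ 2 < N ^ 2 * y ^ 2 + (H * A + K * B) := by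
    refine ⟨(S ^ 2 + |H * A + K * B| + 1) / N ^ 2 + 1, by positivity, fun y hy => ?_⟩
    have hpos : 0 ≤ (S ^ 2 + |H * A + K * B| + 1) / N ^ 2 := by positivity
    have h1 : (S ^ 2 + |H * A + K * B| + 1) / N ^ 2 ≤ y ^ 2 := by nlinarith
    rw [div_le_iff₀ (by positivity)] at h1
    have := neg_abs_le (H * A + K * B)
    linarith
  have hmono : ∀ y ∈ Set.Ici T, StrictMono fun x => g x y := by
    intro y hy x₁ x₂ hx
    have hc := hT y hy
    have e : g x₂ y - g x₁ y = (x₂ - x₁) * (N ^ 2 * (x₂ ^ 2 + x₁ * x₂ + x₁ ^ 2)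
        + N * S * (x₁ + x₂) + (N ^ 2 * y ^ 2 + (H * A + K * B))) := by
      simp only [g]
      ring
    have hpos : 0 < N ^ 2 * (x₂ ^ 2 + x₁ * x₂ + x₁ ^ 2)
        + N * S * (x₁ + x₂) + (N ^ 2 * y ^ 2 + (H * A + K * B)) := by
      nlinarith [sq_nonneg (N * (x₁ + x₂) / 2 + S), sq_nonneg (N * (x₁ + x₂)),
        sq_nonneg (N * (x₁ - x₂))]
    have := mul_pos (sub_pos.2 hx) hpos
    rw [← e] at this
    exact sub_pos.1 this
  have hcont : ContinuousOn ξ (Set.Ici T) :=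
    continuousOn_of_strictMono_root (g := g) (fun x => by fun_prop) hmono fun y _ => hξ y
  -- Replacing `t` by `max t T` makes the path constant before `T`, so it is defined on all of `ℝ`.
  have hcont' : Continuous fun t => ξ (max t T) :=
    hcont.comp_continuous (by fun_prop) fun t => le_max_right t T
  obtain ⟨ζ, hζ⟩ : ∃ ζ : ℝ → ℝ, ζ = fun t => ξ (max t T) := ⟨_, rfl⟩
  rw [← hζ] at hcont'
  have hζ' : ∀ t, ζ t = ξ (max t T) := fun t => by rw [hζ]
  refine ⟨fun t => ⟨A * ζ t - B * max t T, B * ζ t + A * max t T⟩, ?_, fun t => ?_, ?_⟩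
  · simp only [Complex.mk_eq_add_mul_I]
    fun_prop
  · rw [cubicAt_rotated, hζ']
    exact hξ _
  · have hs : 0 < √N := Real.sqrt_pos.2 hN
    refine tendsto_atTop_mono' _ ?_ (tendsto_id.const_mul_atTop hs)
    filter_upwards [eventually_ge_atTop T] with t ht
    rw [max_eq_left ht, id]
    have h0 : 0 ≤ √N * t := mul_nonneg hs.le (hT0.trans ht)
    rw [← abs_of_nonneg h0, ← abs_of_nonneg (norm_nonneg _), ← sq_le_sq, Complex.sq_norm,
      Complex.normSq_apply, mul_pow, Real.sq_sqrt hN.le]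
    simp only [hNdef]
    nlinarith [mul_nonneg hN.le (sq_nonneg (ζ t))]

theorem finrank_direction_eq_one {A B r : ℝ} (hAB : (A, B) ≠ (0, 0)) {ℓ : AffineSubspace ℝ ℂ}
    (hℓ : (ℓ : Set ℂ) = {X | linearPart A B X + r = 0}) : Module.finrank ℝ ℓ.direction = 1 := by
  have hN := (sq_add_sq_pos_of_ne hAB).ne'
  have hmem : ∀ X, X ∈ ℓ ↔ A * X.re + B * X.im + r = 0 := fun X => by
    rw [← SetLike.mem_coe, hℓ, Set.mem_ofPred_eq, linearPart_apply]
  obtain ⟨Q, hQ⟩ : ∃ Q, Q ∈ ℓ := by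
    refine ⟨⟨-A * r / (A ^ 2 + B ^ 2), -B * r / (A ^ 2 + B ^ 2)⟩, ?_⟩
    rw [hmem]
    field_simp
    ring
  have hu : (⟨-B, A⟩ : ℂ) ≠ 0 := by
    intro h
    apply hAB
    have h1 := congrArg Complex.re h
    have h2 := congrArg Complex.im h
    simp at h1 h2
    rw [h1, h2]
  have hdir : ℓ.direction = Submodule.span ℝ {(⟨-B, A⟩ : ℂ)} := by
    ext z
    rw [← AffineSubspace.vadd_mem_iff_mem_direction z hQ, hmem, mem_span_singleton_iff hu]
    rw [hmem] at hQ
    simp [Complex.mul_im]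
    constructor <;> intro h <;> linarith
  rw [hdir, finrank_span_singleton hu]

theorem isAsymptote_iff {A B S H K : ℝ} (hAB : (A, B) ≠ (0, 0)) {P : ℂ} {C : Set ℂ}
    (hC : ∀ X, X ∈ C ↔ cubicAt A B S H K (X - P) = 0) (ℓ : AffineSubspace ℝ ℂ) :
    IsAsymptote C ℓ ↔ (ℓ : Set ℂ) = {X | linearPart A B X + (S - linearPart A B P) = 0} := by
  have hsmall : ∀ ε > 0, ∃ R, ∀ X ∈ C, R ≤ ‖X‖ →
      |linearPart A B X + (S - linearPart A B P)| ≤ ε := by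
    intro ε hε
    obtain ⟨R, hR⟩ := cubicAt_abs_linear_le A B S H K hε
    refine ⟨R + ‖P‖, fun X hX hXR => ?_⟩
    have h1 : R ≤ ‖X - P‖ := by
      have := norm_sub_norm_le X P
      linarith
    have h2 := hR (X - P) ((hC X).1 hX) h1
    rw [map_sub] at h2
    convert h2 using 2
    ring
  refine ⟨isAsymptote_line_unique (linearPart_ne_zero hAB) hsmall, fun hℓ => ?_⟩
  have hN := sq_add_sq_pos_of_ne hAB
  refine ⟨finrank_direction_eq_one hAB hℓ, ?_⟩
  obtain ⟨γ, hγc, hγ0, hγt⟩ := exists_path (S := S) (H := H) (K := K) hAB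
  have hnorm : Tendsto (fun t => ‖γ t + P‖) atTop atTop := by
    refine tendsto_atTop_mono (fun t => ?_) (hγt.atTop_add (tendsto_const_nhds (x := -‖P‖)))
    have := norm_sub_norm_le (γ t) (-P)
    rw [norm_neg, sub_neg_eq_add] at this
    linarith
  have hmemC : ∀ t, γ t + P ∈ C := fun t => by
    rw [hC, add_sub_cancel_right]
    exact hγ0 t
  refine ⟨fun t => γ t + P, by fun_prop, hmemC, hnorm, ?_⟩
  set f : ℂ → ℝ := fun X => linearPart A B X + (S - linearPart A B P) with hf
  have hlim : Tendsto (fun t => f (γ t + P)) atTop (𝓝 0) := by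
    rw [Metric.tendsto_atTop']
    intro ε hε
    obtain ⟨R, hR⟩ := hsmall (ε / 2) (half_pos hε)
    obtain ⟨T, hT⟩ := eventually_atTop.1 (hnorm.eventually_ge_atTop R)
    refine ⟨T, fun t ht => ?_⟩
    have := hR _ (hmemC t) (hT t ht.le)
    rw [Real.dist_0_eq_abs]
    exact lt_of_le_of_lt this (half_lt_self hε)
  have hlim' : Tendsto (fun t => ‖(f (γ t + P) / (A ^ 2 + B ^ 2)) • (⟨A, B⟩ : ℂ)‖) atTop (𝓝 0) := by
    have := ((hlim.div_const (A ^ 2 + B ^ 2)).smul_const (⟨A, B⟩ : ℂ)).norm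
    simpa using this
  refine squeeze_zero (fun _ => Metric.infDist_nonneg) (fun t => ?_) hlim'
  -- The foot of the perpendicular from the path to `ℓ` bounds the distance.
  have hfoot : γ t + P - (f (γ t + P) / (A ^ 2 + B ^ 2)) • (⟨A, B⟩ : ℂ) ∈ (ℓ : Set ℂ) := by
    rw [hℓ, Set.mem_ofPred_eq, map_sub, map_smul]
    have e : linearPart A B ⟨A, B⟩ = A ^ 2 + B ^ 2 := by
      rw [linearPart_apply]
      ring
    rw [e, smul_eq_mul, div_mul_cancel₀ _ hN.ne']
    simp only [hf]
    ring
  refine (Metric.infDist_le_dist_of_mem hfoot).trans_eq ?_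
  rw [dist_eq_norm, sub_sub_cancel]

/-! ### Assembling the theorem. -/

theorem exists_evalAt_homogeneousComponent_ne_zero {φ : MvPolynomial (Fin 2) ℝ} (h0 : φ ≠ 0) {n : ℕ}
    (hdeg : φ.totalDegree = n) (hn : n ≠ 0) :
    ∃ v : ℂ, v ≠ 0 ∧ evalAt (MvPolynomial.homogeneousComponent n φ) v ≠ 0 := by
  by_contra! hzero
  have h3 : MvPolynomial.homogeneousComponent n φ = 0 := by
    refine eq_of_evalAt_eq fun X => ?_
    have hz : evalAt (0 : MvPolynomial (Fin 2) ℝ) X = 0 := map_zero _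
    rw [hz]
    by_cases hX : X = 0
    · have e : ![X.re, X.im] = 0 := by
        ext i
        fin_cases i <;> simp [hX]
      rw [evalAt, e, MvPolynomial.eval_zero, MvPolynomial.constantCoeff_eq,
        MvPolynomial.coeff_homogeneousComponent, if_neg (by simpa using hn.symm)]
    · exact hzero X hX
  obtain ⟨m, hm, hmdeg⟩ := Finset.exists_mem_eq_sup φ.support
    (MvPolynomial.support_nonempty.2 h0) fun s => s.sum fun _ e => e
  have h4 := congrArg (MvPolynomial.coeff m) h3
  have h5 : m.degree = n := by
    rw [← hdeg, MvPolynomial.totalDegree, hmdeg]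
    rfl
  rw [MvPolynomial.coeff_homogeneousComponent, if_pos h5, MvPolynomial.coeff_zero] at h4
  exact MvPolynomial.mem_support_iff.1 hm h4

theorem cubicAt_mul (k A B S H K : ℝ) (Z : ℂ) :
    cubicAt (k * A) (k * B) (k * S) (k * H) (k * K) Z = k * cubicAt A B S H K Z := by
  simp only [cubicAt]
  ring

theorem IsIsogonalCubicOf.exists_center {φ : MvPolynomial (Fin 2) ℝ} (hdeg : φ.totalDegree = 3)
    (hirr : Irreducible φ) {a b c d : ℂ} (h : IsIsogonalCubicOf φ a b c d) :
    ∃ (A B S H K : ℝ) (P : ℂ), (A, B) ≠ (0, 0) ∧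
      (∀ X, evalAt φ X = cubicAt A B S H K (X - P)) ∧
      ∀ P', IsSpiralCenterOf P' a b c d ↔ P' = P := by
  obtain ⟨hnd, hcurve, hinf⟩ := h
  -- If this vector were zero, every direction would be a point at infinity of the cubic, whose
  -- cubic part would then vanish identically.
  have hδ : b + d - a - c ≠ 0 := by
    intro h0
    obtain ⟨v, hv, hne⟩ := exists_evalAt_homogeneousComponent_ne_zero hirr.ne_zero hdeg (by simp)
    apply hne
    rw [hinf v hv, isogonalAtInfinity_iff hv, h0]
    simp
  obtain ⟨P, hP⟩ := exists_mul_eq_mul hδ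
  have hAB : ((b + d - a - c).im, -(b + d - a - c).re) ≠ (0, 0) := by
    intro h0
    rw [Prod.mk.injEq, neg_eq_zero] at h0
    exact hδ (Complex.ext h0.2 h0.1)
  obtain ⟨S, H, K, hF⟩ : ∃ S H K, ∀ X, isogonalForm a b c d X =
      cubicAt (b + d - a - c).im (-(b + d - a - c).re) S H K (X - P) :=
    ⟨_, _, _, isogonalForm_eq_cubicAt hP⟩
  obtain ⟨k, hk0, hk⟩ := exists_eq_mul_evalAt hdeg hirr hAB (fun X hX =>
    (hcurve X).2 ((isogonalForm_eq_zero_iff X).2 ((hF X).trans hX)))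
  refine ⟨k⁻¹ * (b + d - a - c).im, k⁻¹ * -(b + d - a - c).re, k⁻¹ * S, k⁻¹ * H, k⁻¹ * K, P, ?_,
    fun X => ?_, fun P' => ?_⟩
  · intro h0
    apply hAB
    simpa only [Prod.mk.injEq, mul_eq_zero, inv_eq_zero, hk0, false_or] using h0
  · rw [cubicAt_mul, hk, inv_mul_cancel_left₀ hk0]
  · rw [isSpiralCenterOf_iff hnd]
    constructor
    · intro h
      -- The equation for the spiral center is affine in `P'` with slope `b + d - a - c`, so its
      -- solution is unique.
      have : (P' - P) * (b + d - a - c) = 0 := by linear_combination h - hP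
      exact sub_eq_zero.1 ((mul_eq_zero.1 this).resolve_right hδ)
    · rintro rfl
      exact hP

theorem HasForm.isIsogonalCubicOf {φ : MvPolynomial (Fin 2) ℝ} (hirr : Irreducible φ)
    {A B C D E F G : ℝ} (hAB : (A, B) ≠ (0, 0)) (h : HasForm φ A B C D E F G) :
    ∃ a b c d : ℂ, IsIsogonalCubicOf φ a b c d := by
  obtain ⟨S, H, K, -, hφ⟩ := h.evalAt_eq_cubicAt hAB
  have hHK : (H, K) ≠ (0, 0) := by
    intro h0
    rw [Prod.mk.injEq] at h0
    rw [h0.1, h0.2] at hφ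
    exact not_irreducible_of_evalAt_eq hAB hφ hirr
  obtain ⟨a, b, c, d, hnd, hδ, hF⟩ := exists_quadrilateral (S := S) hAB hHK (center A B C D E)
  refine ⟨a, b, c, d, hnd, fun X => ?_, fun v hv => ?_⟩
  · rw [isogonalForm_eq_zero_iff, hF, ← hφ]
    rfl
  · have hv' : v.re ^ 2 + v.im ^ 2 ≠ 0 := by
      have := (Complex.normSq_pos.2 hv).ne'
      rw [Complex.normSq_apply] at this
      simpa only [sq] using this
    rw [h.evalAt_homogeneousComponent, isogonalAtInfinity_iff hv, hδ, mul_eq_zero,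
      or_iff_right hv']
    simp [Complex.mul_im, add_comm]

end IsogonalCubic

open IsogonalCubic in
theorem mainTheorem3 (φ : MvPolynomial (Fin 2) ℝ) (hdeg : φ.totalDegree = 3)
    (hirr : Irreducible φ) :
    ((∃ a b c d : ℂ, IsogonalCubic.IsIsogonalCubicOf φ a b c d) ↔
      ∃ A B C D E F G : ℝ, (A, B) ≠ (0, 0) ∧ IsogonalCubic.HasForm φ A B C D E F G) ∧
    ∀ A B C D E F G : ℝ, (A, B) ≠ (0, 0) → IsogonalCubic.HasForm φ A B C D E F G →
      (∀ P : ℂ, IsogonalCubic.IsSpiralCenterOfCubic φ P ↔ P = IsogonalCubic.center A B C D E) ∧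
      (∀ ℓ : AffineSubspace ℝ ℂ, IsogonalCubic.IsAsymptote (IsogonalCubic.curve φ) ℓ ↔
        (ℓ : Set ℂ) = {X : ℂ | (A ^ 3 + A * B ^ 2) * X.re + (A ^ 2 * B + B ^ 3) * X.im
          + (A ^ 2 * E - A * B * D + B ^ 2 * C) = 0}) := by
  refine ⟨⟨?_, ?_⟩, fun A B C D E F G hAB hform => ⟨fun P => ?_, fun ℓ => ?_⟩⟩
  · rintro ⟨a, b, c, d, h⟩
    obtain ⟨A, B, S, H, K, P, hAB, hφ, -⟩ := h.exists_center hdeg hirr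
    obtain ⟨C, D, E, F, G, hQ⟩ := exists_hasForm (S := S) (H := H) (K := K) (P := P) hAB
    exact ⟨A, B, C, D, E, F, G, hAB, eq_of_evalAt_eq fun X => by rw [hφ, hQ]⟩
  · rintro ⟨A, B, C, D, E, F, G, hAB, h⟩
    exact h.isIsogonalCubicOf hirr hAB
  · obtain ⟨S, H, K, -, hφ⟩ := hform.evalAt_eq_cubicAt hAB
    have hiff : ∀ {a b c d : ℂ}, IsIsogonalCubicOf φ a b c d → ∀ P',
        (IsSpiralCenterOf P' a b c d ↔ P' = center A B C D E) := by
      intro a b c d h P'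
      obtain ⟨A', B', S', H', K', Q, -, hφ', hspiral⟩ := h.exists_center hdeg hirr
      rw [hspiral, cubicAt_shift_injective hAB fun X => (hφ X).symm.trans (hφ' X)]
    obtain ⟨a, b, c, d, h⟩ := hform.isIsogonalCubicOf hirr hAB
    constructor
    · rintro ⟨-, hP⟩
      exact (hiff h P).1 (hP a b c d h)
    · rintro rfl
      exact ⟨⟨a, b, c, d, h⟩, fun a b c d h => (hiff h _).2 rfl⟩
  · obtain ⟨S, H, K, hS, hφ⟩ := hform.evalAt_eq_cubicAt hAB
    have hN := (sq_add_sq_pos_of_ne hAB).ne'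
    rw [isAsymptote_iff (S := S) (H := H) (K := K) hAB (P := center A B C D E)
      (fun X => by rw [← hφ]; rfl)]
    suffices h : {X : ℂ | linearPart A B X + (S - linearPart A B (center A B C D E)) = 0} =
        {X : ℂ | (A ^ 3 + A * B ^ 2) * X.re + (A ^ 2 * B + B ^ 3) * X.im
          + (A ^ 2 * E - A * B * D + B ^ 2 * C) = 0} by rw [h]
    ext X
    -- Multiplying the line equation by `A² + B²` clears the denominators of the center.
    rw [Set.mem_ofPred_eq, Set.mem_ofPred_eq, ← mul_right_inj' hN, mul_zero, linearPart_apply,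
      linearPart_apply, ← hS]
    refine iff_of_eq (congrArg (· = 0) ?_)
    ring
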